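/- All spaces are real. Let $X$ be a renorming of a Hilbert space, that is, a normed space that is linearly homeomorphic to some Hilbert space, with closed unit ball $B_X$ and unit sphere $S_X=\{x\in X:\|x\|=1\}$. We say that $X$ is semitransitive if for all $x,y\in S_X$ there is a linear isomorphism $T$ of $X$ onto itself (bounded, with bounded inverse) with $\|T\|\le 1$ and $Tx=y$. An ellipsoid in $X$ is the image of the closed unit ball of a Hilbert space under a linear isomorphism (bounded, with bounded inverse) of that space onto $X$. A point $x\in S_X$ admits an inner ellipsoid if there is an ellipsoid $E$ with $x\in E\subset B_X$; it admits an outer ellipsoid if there is an ellipsoid $E$ with $B_X\subset E$ and $x\in\partial E$, where $\partial E$ is the topological boundary of $E$ in $X$. Then: 1. $X$ is semitransitive if and only if every point of $S_X$ admits both an inner and an outer ellipsoid. 2. The set of points of $S_X$ that admit an inner ellipsoid is dense in $S_X$. 3. If $X\neq\{0\}$, some point of $S_X$ admits an outer ellipsoid. -/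

import Mathlib

universe u

section RenormedHilbert

variable {X : Type u} [NormedAddCommGroup X] [NormedSpace ℝ X]

/-- An ellipsoid of `X`: the image of the closed unit ball of a real Hilbert space under a linear
isomorphism (bounded, with bounded inverse). A Hilbert space isomorphic to `X` can be transported
to the universe of `X`, so taking `H` there is no restriction. -/
def IsEllipsoid (E : Set X) : Prop :=
  ∃ (H : Type u) (_ : NormedAddCommGroup H) (_ : InnerProductSpace ℝ H) (_ : CompleteSpace H)
    (U : H ≃L[ℝ] X), E = U '' Metric.closedBall (0 : H) 1

/-- The ellipsoid `E` is inner at the point `x` of the unit sphere: `x ∈ E ⊆ B_X`.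
(As `‖x‖ = 1`, this forces `x` to lie on the boundary of `E`.) -/
def IsInnerEllipsoidAt (E : Set X) (x : X) : Prop :=
  IsEllipsoid E ∧ x ∈ E ∧ E ⊆ Metric.closedBall (0 : X) 1

/-- The ellipsoid `E` is outer at the point `x` of the unit sphere: `B_X ⊆ E` and `x` lies on the
boundary of `E`. (Membership `x ∈ E` alone would be automatic here.) -/
def IsOuterEllipsoidAt (E : Set X) (x : X) : Prop :=
  IsEllipsoid E ∧ x ∈ frontier E ∧ Metric.closedBall (0 : X) 1 ⊆ E

def AdmitsInnerEllipsoid (x : X) : Prop := ∃ E : Set X, IsInnerEllipsoidAt E x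

def AdmitsOuterEllipsoid (x : X) : Prop := ∃ E : Set X, IsOuterEllipsoidAt E x

variable (X)

/-- `Aut₁(X)`: the contractive linear isomorphisms of `X` onto itself. -/
def contractiveAut : Set (X ≃L[ℝ] X) := {T | LipschitzWith 1 T}

/-- `X` is semitransitive: any point of the unit sphere is mapped to any other one by some
contractive automorphism. -/
def IsSemitransitive : Prop :=
  ∀ x ∈ Metric.sphere (0 : X) 1, ∀ y ∈ Metric.sphere (0 : X) 1,
    ∃ T ∈ contractiveAut X, y = T x

end RenormedHilbert

open Filter Topology Metric
open scoped InnerProductSpace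

/-!
All three parts rest on writing an ellipsoid as `{x | B x x ≤ 1}` for a bounded symmetric coercive
bilinear form `B` on `X`. It is inner (outer) at a unit vector `x` as soon as `B x x = 1` and
`‖y‖ ^ 2 ≤ B y y` (`B y y ≤ ‖y‖ ^ 2`) for all `y`.

*Existence of touching ellipsoids.* Let `U : K ≃L[ℝ] X` with `K` a Hilbert space. If `‖U k‖ ^ 2`
attained its maximum `M` on the unit sphere of `K`, the form `M * ⟪k, k⟫`, carried to `X`, would
be inner at the maximizer, and a minimizer would give an outer one. Extrema need not be attained
in infinite dimension, but `exists_form_add_isMaxOn_sphere`, a variational principle in the style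
of Borwein and Preiss, says that an even continuous function, bounded above on the unit sphere,
attains its maximum after adding an arbitrarily small positive quadratic form `Q`. Since the
perturbation is itself quadratic, applying the principle to `‖U k‖ ^ 2` and to `-‖U k‖ ^ 2` yields
the forms `M * ⟪k, k⟫ - Q k k` and `M * ⟪k, k⟫ + Q k k`, which still define ellipsoids.

*Density of inner points.* Near a given unit vector `x`, the Hilbert norm of `K` is chosen to be
strongly elongated along `x`: with `φ x = 1`, take `φ y ^ 2` plus a large multiple of the square of
a Hilbert norm of `y - φ y • x`. Every vector of the unit sphere of `K` whose norm in `X` is not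
small then has nearly the direction of `x` or of `-x`, and the touching point found above is one
of these.

*Semitransitivity.* Contractive automorphisms push inner ellipsoids forward and pull outer
ellipsoids back, so in a semitransitive space one inner and one outer point suffice. Conversely, an
outer ellipsoid at `x` is a contraction `X → K` taking `x` to a unit vector, an inner ellipsoid at
`y` is a contraction `L → X` taking a unit vector to `y`, and `K`, `L` are isomorphic, hence
isometric Hilbert spaces (`ContinuousLinearEquiv.nonempty_linearIsometryEquiv`); composing with a
reflection matches the two unit vectors.
-/

/-! ### Isomorphic Hilbert spaces are isometric -/

/-- For each `i`, only countably many `c j` are not orthogonal to `A (b i)`, and every `c j` is not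
orthogonal to some `A (b i)` because `A` has dense range. So `κ` is a union of `ι` many countable
sets. -/
theorem HilbertBasis.mk_le_mk_of_continuousLinearEquiv {ι κ E F : Type u}
    [NormedAddCommGroup E] [InnerProductSpace ℝ E]
    [NormedAddCommGroup F] [InnerProductSpace ℝ F]
    [Infinite ι] (b : HilbertBasis ι ℝ E) (c : HilbertBasis κ ℝ F) (A : E ≃L[ℝ] F) :
    Cardinal.mk κ ≤ Cardinal.mk ι := by
  have hcov : (⋃ i, {j | ⟪c j, A (b i)⟫_ℝ ≠ 0}) = Set.univ := by
    refine Set.eq_univ_of_forall fun j => ?_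
    by_contra hj
    simp only [Set.mem_iUnion, Set.mem_ofPred_eq, not_exists, not_not] at hj
    have h0 : (innerSL ℝ (c j)).comp (A : E →L[ℝ] F) = 0 := by
      refine ContinuousLinearMap.ext_on (s := Set.range b)
        (Submodule.dense_iff_topologicalClosure_eq_top.2 b.dense_span) ?_
      · rintro _ ⟨i, rfl⟩
        simpa using hj i
    have h1 := DFunLike.congr_fun h0 (A.symm (c j))
    simp [c.orthonormal.1 j] at h1
  have hcount (i : ι) : {j | ⟪c j, A (b i)⟫_ℝ ≠ 0}.Countable := by
    have h := (c.summable_inner_mul_inner (A (b i)) (A (b i))).countable_support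
    refine h.mono fun j hj => ?_
    simpa [real_inner_comm] using hj
  calc Cardinal.mk κ = Cardinal.mk (⋃ i, {j | ⟪c j, A (b i)⟫_ℝ ≠ 0}) := by
        rw [hcov, Cardinal.mk_univ]
    _ ≤ Cardinal.mk ι * ⨆ i, Cardinal.mk {j | ⟪c j, A (b i)⟫_ℝ ≠ 0} := Cardinal.mk_iUnion_le _
    _ ≤ Cardinal.mk ι * Cardinal.aleph0 := by
        gcongr
        exact ciSup_le' fun i => (Cardinal.le_aleph0_iff_set_countable).2 (hcount i)
    _ = Cardinal.mk ι := Cardinal.mul_aleph0_eq (Cardinal.infinite_iff.1 ‹_›)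

/-- Linearly homeomorphic Hilbert spaces are isometric: their Hilbert bases have the same
cardinality. -/
theorem ContinuousLinearEquiv.nonempty_linearIsometryEquiv {E F : Type u}
    [NormedAddCommGroup E] [InnerProductSpace ℝ E] [CompleteSpace E]
    [NormedAddCommGroup F] [InnerProductSpace ℝ F] [CompleteSpace F] (A : E ≃L[ℝ] F) :
    Nonempty (E ≃ₗᵢ[ℝ] F) := by
  by_cases hE : FiniteDimensional ℝ E
  · have := A.toLinearEquiv.finiteDimensional
    exact ⟨(stdOrthonormalBasis ℝ E).equiv (stdOrthonormalBasis ℝ F)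
      (finCongr A.toLinearEquiv.finrank_eq)⟩
  · obtain ⟨s, b, -⟩ := exists_hilbertBasis ℝ E
    obtain ⟨t, c, -⟩ := exists_hilbertBasis ℝ F
    have hs : Infinite s := by
      by_contra h
      rw [not_infinite_iff_finite] at h
      have := Fintype.ofFinite s
      exact hE b.toOrthonormalBasis.toBasis.finiteDimensional_of_finite
    have ht : Infinite t := by
      by_contra h
      rw [not_infinite_iff_finite] at h
      have := Fintype.ofFinite t
      have := c.toOrthonormalBasis.toBasis.finiteDimensional_of_finite
      exact hE A.symm.toLinearEquiv.finiteDimensional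
    obtain ⟨e⟩ := Cardinal.eq.1 <|
      (HilbertBasis.mk_le_mk_of_continuousLinearEquiv c b A.symm).antisymm
        (HilbertBasis.mk_le_mk_of_continuousLinearEquiv b c A)
    let c' : HilbertBasis s ℝ F := HilbertBasis.mk (v := c ∘ e)
      (c.orthonormal.comp e e.injective) (by
        rw [e.surjective.range_comp]; exact c.dense_span.ge)
    exact ⟨b.repr.trans c'.repr.symm⟩

/-! ### A quadratic variational principle -/

/-- The inner product of a real space as a bounded bilinear form: `innerSL ℝ`, with the conjugation
in its type replaced by the identity of `ℝ`. -/
noncomputable def innerForm (K : Type*) [NormedAddCommGroup K] [InnerProductSpace ℝ K] :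
    K →L[ℝ] K →L[ℝ] ℝ :=
  innerSL ℝ

theorem innerForm_apply {K : Type*} [NormedAddCommGroup K] [InnerProductSpace ℝ K] (u v : K) :
    innerForm K u v = ⟪u, v⟫_ℝ :=
  rfl

/-- The rank one quadratic form `v ↦ ⟪w, v⟫ ^ 2`, as a symmetric bilinear form. -/
noncomputable def rankOneForm {K : Type*} [NormedAddCommGroup K] [InnerProductSpace ℝ K] (w : K) :
    K →L[ℝ] K →L[ℝ] ℝ :=
  (innerSL ℝ w).smulRight (innerSL ℝ w)

theorem rankOneForm_apply {K : Type*} [NormedAddCommGroup K] [InnerProductSpace ℝ K] (w u v : K) :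
    rankOneForm w u v = ⟪w, u⟫_ℝ * ⟪w, v⟫_ℝ := by
  simp [rankOneForm]

theorem norm_rankOneForm {K : Type*} [NormedAddCommGroup K] [InnerProductSpace ℝ K] (w : K) :
    ‖rankOneForm w‖ = ‖w‖ * ‖w‖ := by
  simp [rankOneForm, ContinuousLinearMap.norm_smulRight_apply]

/-- The greedy sequence behind the variational principle: `z n` nearly maximizes `f + Q n` on the
unit sphere, with tolerance `η n`, and `Q (n + 1)` rewards the direction `z n` with weight `a n`.
Since `f` and the forms are even, signs can be chosen so that consecutive `z n` make a nonobtuse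
angle. -/
theorem exists_seq_form_of_bddAbove_sphere {K : Type*} [NormedAddCommGroup K]
    [InnerProductSpace ℝ K] [Nontrivial K] {f : K → ℝ} (heven : ∀ z, f (-z) = f z)
    (hbdd : BddAbove (f '' sphere 0 1)) (a : ℕ → ℝ) {η : ℕ → ℝ} (hη : ∀ n, 0 < η n) :
    ∃ (Q : ℕ → K →L[ℝ] K →L[ℝ] ℝ) (z : ℕ → K), Q 0 = 0 ∧
      (∀ n, Q (n + 1) = Q n + a n • rankOneForm (z n)) ∧ (∀ n, ‖z n‖ = 1) ∧
      (∀ n, 0 ≤ ⟪z n, z (n + 1)⟫_ℝ) ∧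
      ∀ n v, ‖v‖ = 1 → f v + Q n v v ≤ f (z n) + Q n (z n) (z n) + η n := by
  have hstep (Q : K →L[ℝ] K →L[ℝ] ℝ) (z : K) (n : ℕ) : ∃ w : K, ‖w‖ = 1 ∧
      0 ≤ ⟪z, w⟫_ℝ ∧ ∀ v, ‖v‖ = 1 → f v + Q v v ≤ f w + Q w w + η n := by
    obtain ⟨C, hC⟩ := hbdd
    have hne : ((fun v => f v + Q v v) '' sphere 0 1).Nonempty :=
      (NormedSpace.sphere_nonempty.2 zero_le_one).image _
    have hb : BddAbove ((fun v => f v + Q v v) '' sphere 0 1) := by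
      refine ⟨C + ‖Q‖, ?_⟩
      rintro _ ⟨v, hv, rfl⟩
      have h1 := hC ⟨v, hv, rfl⟩
      have h2 := (le_abs_self _).trans (Q.le_opNorm₂ v v)
      rw [mem_sphere_zero_iff_norm] at hv
      rw [hv, mul_one, mul_one] at h2
      exact add_le_add h1 h2
    obtain ⟨_, ⟨w, hw, rfl⟩, hlt⟩ := exists_lt_of_lt_csSup hne (sub_lt_self _ (hη n))
    rw [mem_sphere_zero_iff_norm] at hw
    have hmax (v : K) (hv : ‖v‖ = 1) : f v + Q v v ≤ f w + Q w w + η n := by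
      have := le_csSup hb ⟨v, mem_sphere_zero_iff_norm.2 hv, rfl⟩
      dsimp only at this hlt
      linarith
    rcases le_total 0 ⟪z, w⟫_ℝ with h | h
    · exact ⟨w, hw, h, hmax⟩
    · refine ⟨-w, by rwa [norm_neg], by rwa [inner_neg_right, Left.nonneg_neg_iff], ?_⟩
      simpa [heven] using hmax
  choose W hW1 hW2 hW3 using hstep
  let s (n : ℕ) : (K →L[ℝ] K →L[ℝ] ℝ) × K :=
    Nat.rec (0, 0) (fun n p => (p.1 + a n • rankOneForm (W p.1 p.2 n), W p.1 p.2 n)) n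
  exact ⟨fun n => (s n).1, fun n => (s (n + 1)).2, rfl, fun _ => rfl, fun _ => hW1 _ _ _,
    fun _ => hW2 _ _ _, fun _ v hv => hW3 _ _ _ v hv⟩

/-- A quadratic variational principle. In the greedy sequence with tolerances much smaller than the
weights `a n`, a near maximizer after `z n` has been rewarded must be close to `z n`, so the `z n`
converge, and their limit maximizes `f` plus the sum of all the rewards. -/
theorem exists_form_add_isMaxOn_sphere {K : Type*} [NormedAddCommGroup K] [InnerProductSpace ℝ K]
    [CompleteSpace K] [Nontrivial K] {f : K → ℝ} (hf : Continuous f) (heven : ∀ z, f (-z) = f z)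
    (hbdd : BddAbove (f '' sphere 0 1)) {ε : ℝ} (hε : 0 < ε) :
    ∃ (Q : K →L[ℝ] K →L[ℝ] ℝ) (z : K), (∀ v w, Q v w = Q w v) ∧ (∀ v, 0 ≤ Q v v) ∧
      (∀ v, Q v v ≤ ε * ‖v‖ ^ 2) ∧ ‖z‖ = 1 ∧
      ∀ v, ‖v‖ = 1 → f v + Q v v ≤ f z + Q z z := by
  -- The weights sum to `ε`; the tolerances `a n / 4 ^ n` force `‖z n - z (n + 1)‖ ≤ 2 / 2 ^ n`.
  let a (n : ℕ) : ℝ := ε / 2 / 2 ^ n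
  have ha (n : ℕ) : 0 < a n := by positivity
  obtain ⟨Q, z, hQ0, hQs, hz1, hz2, hz3⟩ := exists_seq_form_of_bddAbove_sphere heven hbdd a
    (η := fun n => a n / 4 ^ n) (fun n => div_pos (ha n) (by positivity))
  have hQv (n : ℕ) (v w : K) : Q (n + 1) v w = Q n v w + a n * (⟪z n, v⟫_ℝ * ⟪z n, w⟫_ℝ) := by
    rw [hQs]; simp [rankOneForm_apply]
  have hsymm (n : ℕ) (v w : K) : Q n v w = Q n w v := by
    induction n with
    | zero => simp [hQ0]
    | succ n ih => rw [hQv, hQv, ih, mul_comm ⟪z n, v⟫_ℝ]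
  have hpos (n : ℕ) (v : K) : 0 ≤ Q n v v := by
    induction n with
    | zero => simp [hQ0]
    | succ n ih => rw [hQv]; exact add_nonneg ih (mul_nonneg (ha n).le (mul_self_nonneg _))
  have hle (n : ℕ) (v : K) : Q n v v ≤ (ε - ε / 2 ^ n) * ‖v‖ ^ 2 := by
    induction n with
    | zero => simp [hQ0]
    | succ n ih =>
      have h1 : ⟪z n, v⟫_ℝ * ⟪z n, v⟫_ℝ ≤ ‖v‖ ^ 2 := by
        have := real_inner_mul_inner_self_le (z n) v
        simpa [real_inner_self_eq_norm_sq, hz1] using this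
      have h2 := mul_le_mul_of_nonneg_left h1 (ha n).le
      have h3 : ε - ε / 2 ^ (n + 1) = (ε - ε / 2 ^ n) + a n := by
        simp only [a]; field_simp; ring
      rw [hQv, h3, add_mul]
      exact add_le_add ih h2
  have hQc : CauchySeq Q := by
    refine cauchySeq_of_le_geometric_two (C := ε) (f := Q) fun n => ?_
    refine ((dist_comm _ _).trans (dist_eq_norm (Q (n + 1)) (Q n))).trans_le ?_
    rw [sub_eq_of_eq_add' (hQs n)]
    refine (ContinuousLinearMap.opNorm_smul_le _ _).trans_eq ?_
    rw [norm_rankOneForm, hz1, mul_one, mul_one, Real.norm_of_nonneg (ha n).le]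
  have hzc : CauchySeq z := by
    refine cauchySeq_of_le_geometric_two (C := 4) (f := z) fun n => ?_
    have h1 := hz3 n (z (n + 1)) (hz1 (n + 1))
    have h2 := hz3 (n + 1) (z n) (hz1 n)
    rw [hQv, hQv, real_inner_self_eq_norm_sq, hz1] at h2
    have h3 : a (n + 1) / 4 ^ (n + 1) ≤ a n / 4 ^ n := by
      simp only [a]
      gcongr <;> norm_num
    set t := ⟪z n, z (n + 1)⟫_ℝ with ht
    have ht1 : t ≤ 1 := by
      simpa [hz1] using real_inner_le_norm (z n) (z (n + 1))
    -- The reward for the direction `z n` that `z (n + 1)` misses is at most the sum of two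
    -- tolerances.
    have h4 : a n * (1 - t * t) ≤ a n * (2 / 4 ^ n) := by
      have : a n * (2 / 4 ^ n) = a n / 4 ^ n + a n / 4 ^ n := by ring
      rw [this]
      linarith
    have h5 := le_of_mul_le_mul_left h4 (ha n)
    -- The nonobtuse angle turns closeness of the lines into closeness of the vectors.
    have h6 : t * t ≤ t := mul_le_of_le_one_left (hz2 n) ht1
    rw [dist_eq_norm]
    refine abs_le_of_sq_le_sq' ?_ (by positivity) |>.2
    rw [norm_sub_sq_real, hz1 n, hz1 (n + 1), ← ht]
    have h7 : (4 / 2 / 2 ^ n : ℝ) ^ 2 = 2 * (2 / 4 ^ n) := by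
      rw [show (4 : ℝ) ^ n = (2 ^ n) ^ 2 by rw [← pow_mul, mul_comm, pow_mul]; norm_num]
      ring
    rw [h7]
    linarith
  obtain ⟨Q', hQ'⟩ := cauchySeq_tendsto_of_complete hQc
  obtain ⟨z', hz'⟩ := cauchySeq_tendsto_of_complete hzc
  have happly {g h : ℕ → K} {v w : K} (hg : Tendsto g atTop (𝓝 v)) (hh : Tendsto h atTop (𝓝 w)) :
      Tendsto (fun n => Q n (g n) (h n)) atTop (𝓝 (Q' v w)) := by
    have hc : Continuous fun p : (K →L[ℝ] K →L[ℝ] ℝ) × K × K => p.1 p.2.1 p.2.2 := by fun_prop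
    exact (hc.tendsto (Q', v, w)).comp (hQ'.prodMk_nhds (hg.prodMk_nhds hh))
  have hQ'v (v w : K) : Tendsto (fun n => Q n v w) atTop (𝓝 (Q' v w)) :=
    happly tendsto_const_nhds tendsto_const_nhds
  refine ⟨Q', z', fun v w => ?_, fun v => ?_, fun v => ?_, ?_, fun v hv => ?_⟩
  · exact tendsto_nhds_unique (hQ'v v w) ((hQ'v w v).congr fun n => hsymm n w v)
  · exact ge_of_tendsto' (hQ'v v v) fun n => hpos n v
  · refine le_of_tendsto' (hQ'v v v) fun n => (hle n v).trans ?_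
    gcongr
    exact sub_le_self _ (by positivity)
  · exact tendsto_nhds_unique hz'.norm (by simp [hz1])
  · have hη : Tendsto (fun n => a n / 4 ^ n) atTop (𝓝 0) := by
      have h : Tendsto (fun n : ℕ => ε / 2 * ((8 : ℝ)⁻¹) ^ n) atTop (𝓝 (ε / 2 * 0)) :=
        (tendsto_pow_atTop_nhds_zero_of_lt_one (by norm_num) (by norm_num)).const_mul _
      rw [mul_zero] at h
      refine h.congr fun n => ?_
      simp only [a]
      rw [inv_pow, show (8 : ℝ) = 2 * 4 by norm_num, mul_pow]
      field_simp
    have hlim : Tendsto (fun n => f (z n) + Q n (z n) (z n) + a n / 4 ^ n) atTop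
        (𝓝 (f z' + Q' z' z' + 0)) :=
      (((hf.tendsto z').comp hz').add (happly hz' hz')).add hη
    rw [add_zero] at hlim
    exact le_of_tendsto_of_tendsto' (tendsto_const_nhds.add (hQ'v v v)) hlim
      fun n => hz3 n v hv

section Renorming

variable {X : Type u} [NormedAddCommGroup X] [NormedSpace ℝ X]

/-! ### Ellipsoids and quadratic forms -/

/-- A copy of `X` without its norm, meant to carry the inner product given by the bilinear
form `B`. -/
def FormSpace (_B : X →L[ℝ] X →L[ℝ] ℝ) : Type u := X

namespace FormSpace

variable (B : X →L[ℝ] X →L[ℝ] ℝ)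

instance : AddCommGroup (FormSpace B) := inferInstanceAs (AddCommGroup X)

instance : Module ℝ (FormSpace B) := inferInstanceAs (Module ℝ X)

/-- The identity map from the copy of `X` onto `X`. -/
def toOriginal : FormSpace B ≃ₗ[ℝ] X := LinearEquiv.refl ℝ X

variable {B}

/-- The inner product on the copy of `X` given by a coercive symmetric form. -/
@[reducible] noncomputable def core (hsymm : ∀ x y, B x y = B y x) {c : ℝ} (hc : 0 < c)
    (hB : ∀ x, c * ‖x‖ ^ 2 ≤ B x x) : InnerProductSpace.Core ℝ (FormSpace B) where
  inner x y := B (toOriginal B x) (toOriginal B y)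
  conj_inner_symm x y := hsymm _ _
  re_inner_nonneg x := (by positivity : 0 ≤ c * ‖toOriginal B x‖ ^ 2).trans (hB _)
  add_left x y z := by simp
  smul_left x y r := by simp
  definite x hx := by
    by_contra h
    have : 0 < c * ‖toOriginal B x‖ ^ 2 := by
      have : toOriginal B x ≠ 0 := by simpa using h
      positivity
    exact absurd hx (this.trans_le (hB _)).ne'

end FormSpace

/-- A coercive symmetric bounded form is the inner product of a Hilbert space isomorphic to `X`. -/
theorem exists_innerProductSpace_of_coercive [CompleteSpace X] (B : X →L[ℝ] X →L[ℝ] ℝ)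
    (hsymm : ∀ x y, B x y = B y x) {c : ℝ} (hc : 0 < c) (hB : ∀ x, c * ‖x‖ ^ 2 ≤ B x x) :
    ∃ (K : Type u) (_ : NormedAddCommGroup K) (_ : InnerProductSpace ℝ K) (_ : CompleteSpace K)
      (U : K ≃L[ℝ] X), ∀ k, ‖k‖ ^ 2 = B (U k) (U k) := by
  let N : NormedAddCommGroup (FormSpace B) := (FormSpace.core hsymm hc hB).toNormedAddCommGroup
  let I : InnerProductSpace ℝ (FormSpace B) := .ofCore (FormSpace.core hsymm hc hB).toCore
  have hn (k : FormSpace B) :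
      ‖k‖ ^ 2 = B (FormSpace.toOriginal B k) (FormSpace.toOriginal B k) :=
    (real_inner_self_eq_norm_sq k).symm
  let U : FormSpace B ≃L[ℝ] X :=
    (FormSpace.toOriginal B).toContinuousLinearEquivOfBounds (√c⁻¹) (√‖B‖)
      (fun k => by
        refine abs_le_of_sq_le_sq' ?_ (by positivity) |>.2
        rw [mul_pow, Real.sq_sqrt (by positivity), hn, inv_mul_eq_div, le_div_iff₀ hc, mul_comm]
        exact hB _)
      (fun x => by
        refine abs_le_of_sq_le_sq' ?_ (by positivity) |>.2
        rw [mul_pow, Real.sq_sqrt (by positivity), hn, LinearEquiv.apply_symm_apply, sq,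
          ← mul_assoc]
        exact (le_abs_self _).trans (B.le_opNorm₂ x x))
  exact ⟨FormSpace B, N, I, (completeSpace_congr (e := U.toEquiv) U.isUniformEmbedding).2 ‹_›,
    U, hn⟩

theorem IsEllipsoid.image {E : Set X} (hE : IsEllipsoid E) (T : X ≃L[ℝ] X) :
    IsEllipsoid (T '' E) := by
  obtain ⟨H, _, _, _, U, rfl⟩ := hE
  exact ⟨H, _, _, ‹_›, U.trans T, by rw [← Set.image_comp]; rfl⟩

theorem ContinuousLinearEquiv.frontier_image_closedBall {H : Type*} [NormedAddCommGroup H]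
    [NormedSpace ℝ H] (U : H ≃L[ℝ] X) :
    frontier (U '' closedBall (0 : H) 1) = U '' sphere (0 : H) 1 := by
  rw [← frontier_closedBall (0 : H) one_ne_zero]
  exact (U.toHomeomorph.image_frontier _).symm

theorem admitsOuterEllipsoid_of_form [CompleteSpace X] (B : X →L[ℝ] X →L[ℝ] ℝ)
    (hsymm : ∀ x y, B x y = B y x) {c : ℝ} (hc : 0 < c) (hB : ∀ x, c * ‖x‖ ^ 2 ≤ B x x)
    (hle : ∀ x, B x x ≤ ‖x‖ ^ 2) {x : X} (hx : B x x = 1) : AdmitsOuterEllipsoid x := by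
  obtain ⟨K, _, _, _, U, hU⟩ := exists_innerProductSpace_of_coercive B hsymm hc hB
  refine ⟨U '' closedBall 0 1, ⟨K, _, _, ‹_›, U, rfl⟩, ?_, fun y hy => ⟨U.symm y, ?_, by simp⟩⟩
  · rw [U.frontier_image_closedBall]
    refine ⟨U.symm x, ?_, by simp⟩
    rw [mem_sphere_zero_iff_norm, ← pow_eq_one_iff_of_nonneg (norm_nonneg _) two_ne_zero, hU,
      U.apply_symm_apply, hx]
  · rw [mem_closedBall_zero_iff] at hy ⊢
    rw [← sq_le_one_iff₀ (norm_nonneg _), hU, U.apply_symm_apply]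
    exact (hle y).trans (pow_le_one₀ (norm_nonneg y) hy)

theorem admitsInnerEllipsoid_of_form [CompleteSpace X] (B : X →L[ℝ] X →L[ℝ] ℝ)
    (hsymm : ∀ x y, B x y = B y x) (hle : ∀ x, ‖x‖ ^ 2 ≤ B x x) {x : X} (hx : B x x = 1) :
    AdmitsInnerEllipsoid x := by
  obtain ⟨K, _, _, _, U, hU⟩ :=
    exists_innerProductSpace_of_coercive B hsymm one_pos (by simpa using hle)
  refine ⟨U '' closedBall 0 1, ⟨K, _, _, ‹_›, U, rfl⟩, ⟨U.symm x, ?_, by simp⟩, ?_⟩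
  · rw [mem_closedBall_zero_iff, ← sq_le_one_iff₀ (norm_nonneg _), hU, U.apply_symm_apply, hx]
  · rintro _ ⟨k, hk, rfl⟩
    rw [mem_closedBall_zero_iff] at hk ⊢
    rw [← sq_le_one_iff₀ (norm_nonneg _)]
    exact (hle _).trans ((hU k).symm.trans_le (pow_le_one₀ (norm_nonneg k) hk))

theorem AdmitsInnerEllipsoid.map {x : X} (hx : AdmitsInnerEllipsoid x) {T : X ≃L[ℝ] X}
    (hT : ∀ x, ‖T x‖ ≤ ‖x‖) : AdmitsInnerEllipsoid (T x) := by
  obtain ⟨E, hE, hxE, hEB⟩ := hx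
  refine ⟨T '' E, hE.image T, Set.mem_image_of_mem T hxE, ?_⟩
  rintro _ ⟨z, hz, rfl⟩
  have := hEB hz
  rw [mem_closedBall_zero_iff] at this ⊢
  exact (hT z).trans this

theorem AdmitsOuterEllipsoid.of_map {x : X} {T : X ≃L[ℝ] X} (hT : ∀ x, ‖T x‖ ≤ ‖x‖)
    (hx : AdmitsOuterEllipsoid (T x)) : AdmitsOuterEllipsoid x := by
  obtain ⟨E, hE, hxE, hEB⟩ := hx
  refine ⟨T.symm '' E, hE.image T.symm, ?_, fun z hz => ⟨T z, hEB ?_, by simp⟩⟩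
  · have := T.symm.toHomeomorph.image_frontier E
    exact this.subset ⟨T x, hxE, T.symm_apply_apply x⟩
  · rw [mem_closedBall_zero_iff] at hz ⊢
    exact (hT z).trans hz

/-! ### Touching ellipsoids of a renormed Hilbert space -/

/-- A function that is homogeneous of degree two is nonnegative if it is so on the unit sphere. -/
theorem nonneg_of_nonneg_on_sphere {K : Type*} [NormedAddCommGroup K] [NormedSpace ℝ K]
    {G : K → ℝ} (hG : ∀ (r : ℝ) k, G (r • k) = r ^ 2 * G k) (h : ∀ k, ‖k‖ = 1 → 0 ≤ G k) (k : K) :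
    0 ≤ G k := by
  rcases eq_or_ne k 0 with rfl | hk
  · simpa using (hG 0 0).ge
  · have h1 := h (‖k‖⁻¹ • k) (norm_smul_inv_norm hk)
    rw [hG] at h1
    exact nonneg_of_mul_nonneg_right h1 (by positivity)

/-- A near maximizer `k` of `‖U k‖` on the unit sphere of `K` can be chosen so that `U k`, normalized,
admits an inner ellipsoid. -/
theorem exists_admitsInnerEllipsoid_of_continuousLinearEquiv {K : Type*} [NormedAddCommGroup K]
    [InnerProductSpace ℝ K] [CompleteSpace K] [Nontrivial K] (U : K ≃L[ℝ] X) {δ : ℝ}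
    (hδ : 0 < δ) :
    ∃ k, ‖k‖ = 1 ∧ AdmitsInnerEllipsoid (‖U k‖⁻¹ • U k) ∧
      ∀ v, ‖v‖ = 1 → ‖U v‖ ^ 2 - δ ≤ ‖U k‖ ^ 2 := by
  have := (completeSpace_congr (e := U.toEquiv) U.isUniformEmbedding).1 ‹_›
  obtain ⟨Q, k, hsymm, hpos, hle, hk, hmax⟩ := exists_form_add_isMaxOn_sphere
    (f := fun k => ‖U k‖ ^ 2) (by fun_prop) (by simp) ⟨‖(U : K →L[ℝ] X)‖ ^ 2, by
      rintro _ ⟨v, hv, rfl⟩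
      rw [mem_sphere_zero_iff_norm] at hv
      have := (U : K →L[ℝ] X).le_opNorm v
      rw [hv, mul_one] at this
      exact pow_le_pow_left₀ (norm_nonneg _) this 2⟩ hδ
  refine ⟨k, hk, ?_, fun v hv => ?_⟩
  · have hUk : ‖U k‖ ≠ 0 := by
      have : k ≠ 0 := by rintro rfl; simp at hk
      simpa using this
    set M := ‖U k‖ ^ 2 + Q k k with hM
    have hall (v : K) : ‖U v‖ ^ 2 ≤ M * ‖v‖ ^ 2 - Q v v := by
      have := nonneg_of_nonneg_on_sphere (G := fun v => M * ‖v‖ ^ 2 - Q v v - ‖U v‖ ^ 2)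
        (fun r k => by simp [norm_smul, mul_pow]; ring) (fun v hv => by
          have := hmax v hv
          rw [hv]; linarith) v
      linarith
    let B : X →L[ℝ] X →L[ℝ] ℝ := (M • innerForm K - Q).bilinearComp
      (U.symm : X →L[ℝ] K) (U.symm : X →L[ℝ] K)
    have hB (x y : X) : B x y = M * ⟪U.symm x, U.symm y⟫_ℝ - Q (U.symm x) (U.symm y) := by
      simp [B, innerForm_apply]
    refine admitsInnerEllipsoid_of_form B (fun x y => ?_) (fun x => ?_) ?_
    · rw [hB, hB, hsymm, real_inner_comm]
    · rw [hB, real_inner_self_eq_norm_sq]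
      simpa using hall (U.symm x)
    · simp only [map_smul, smul_apply, hB, U.symm_apply_apply,
        real_inner_self_eq_norm_sq, hk, hM, smul_eq_mul]
      field_simp
      ring
  · linarith [hmax v hv, hpos v, hle k, hk ▸ hle k]

theorem exists_admitsOuterEllipsoid_of_continuousLinearEquiv {K : Type*} [NormedAddCommGroup K]
    [InnerProductSpace ℝ K] [CompleteSpace K] [Nontrivial K] (U : K ≃L[ℝ] X) :
    ∃ x : X, ‖x‖ = 1 ∧ AdmitsOuterEllipsoid x := by
  have := (completeSpace_congr (e := U.toEquiv) U.isUniformEmbedding).1 ‹_›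
  set C := ‖(U.symm : X →L[ℝ] K)‖ + 1 with hC
  have hC0 : 0 < C := by positivity
  have hCle (x : X) : ‖U.symm x‖ ≤ C * ‖x‖ :=
    ((U.symm : X →L[ℝ] K).le_opNorm x).trans (by gcongr; simp [hC])
  set D := ‖(U : K →L[ℝ] X)‖ + 1 with hD
  have hD0 : 0 < D := by positivity
  have hDle (k : K) : ‖U k‖ ≤ D * ‖k‖ :=
    ((U : K →L[ℝ] X).le_opNorm k).trans (by gcongr; simp [hD])
  -- `(1 / C) ^ 2` bounds `‖U v‖ ^ 2` below on the unit sphere, so a perturbation of size at most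
  -- half of it leaves the factor `M` below positive.
  set ε := (1 / C) ^ 2 / 2 with hεdef
  have hε : 0 < ε := by positivity
  obtain ⟨Q, k, hsymm, hpos, hle, hk, hmax⟩ := exists_form_add_isMaxOn_sphere
    (f := fun k => - ‖U k‖ ^ 2) (by fun_prop) (by simp) ⟨0, by
      rintro _ ⟨v, hv, rfl⟩
      simp⟩ hε
  have hUk : 1 / C ≤ ‖U k‖ := by
    rw [div_le_iff₀' hC0]
    simpa [hk] using hCle (U k)
  have hUk0 : 0 < ‖U k‖ := (by positivity : 0 < 1 / C).trans_le hUk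
  set M := ‖U k‖ ^ 2 - Q k k with hM
  have hM0 : ε ≤ M := by
    have h1 := hle k
    have h2 := pow_le_pow_left₀ (by positivity) hUk 2
    rw [hk] at h1
    linarith
  have hall (v : K) : M * ‖v‖ ^ 2 + Q v v ≤ ‖U v‖ ^ 2 := by
    have := nonneg_of_nonneg_on_sphere (G := fun v => ‖U v‖ ^ 2 - (M * ‖v‖ ^ 2 + Q v v))
      (fun r k => by simp [norm_smul, mul_pow]; ring) (fun v hv => by
        have := hmax v hv
        rw [hv]; linarith) v
    linarith
  let B : X →L[ℝ] X →L[ℝ] ℝ := (M • innerForm K + Q).bilinearComp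
    (U.symm : X →L[ℝ] K) (U.symm : X →L[ℝ] K)
  have hB (x y : X) : B x y = M * ⟪U.symm x, U.symm y⟫_ℝ + Q (U.symm x) (U.symm y) := by
    simp [B, innerForm_apply]
  refine ⟨‖U k‖⁻¹ • U k, norm_smul_inv_norm (norm_pos_iff.1 hUk0),
    admitsOuterEllipsoid_of_form B (c := ε * (1 / D) ^ 2) (fun x y => ?_) (by positivity)
      (fun x => ?_) (fun x => ?_) ?_⟩
  · rw [hB, hB, hsymm, real_inner_comm]
  · rw [hB, real_inner_self_eq_norm_sq, mul_assoc, ← mul_pow]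
    have h : 1 / D * ‖x‖ ≤ ‖U.symm x‖ := by
      rw [one_div, inv_mul_le_iff₀ hD0]
      simpa using hDle (U.symm x)
    have hM0' : 0 ≤ M := hε.le.trans hM0
    have : ε * (1 / D * ‖x‖) ^ 2 ≤ M * ‖U.symm x‖ ^ 2 := by gcongr
    linarith [hpos (U.symm x)]
  · rw [hB, real_inner_self_eq_norm_sq]
    simpa using hall (U.symm x)
  · simp only [map_smul, smul_apply, hB, U.symm_apply_apply,
      real_inner_self_eq_norm_sq, hk, hM, smul_eq_mul]
    field_simp
    ring

theorem norm_inv_smul_sub_le {x z : X} (hx : ‖x‖ = 1) (hz : z ≠ 0) {a τ : ℝ} (ha : 0 ≤ a)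
    (h : ‖z - a • x‖ ≤ τ) : ‖‖z‖⁻¹ • z - x‖ ≤ 2 * τ / ‖z‖ := by
  have hz' : 0 < ‖z‖ := norm_pos_iff.2 hz
  have h1 : |‖z‖ - a| ≤ τ := by
    have := abs_norm_sub_norm_le z (a • x)
    rw [norm_smul, hx, mul_one, Real.norm_of_nonneg ha] at this
    exact this.trans h
  have h2 : ‖z - ‖z‖ • x‖ ≤ 2 * τ := by
    -- The multiple `a • x` may be replaced by `‖z‖ • x`, since `a = ‖a • x‖` is within `τ` of `‖z‖`.
    have : z - ‖z‖ • x = (z - a • x) - (‖z‖ - a) • x := by module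
    rw [this]
    refine (norm_sub_le _ _).trans ?_
    rw [norm_smul, hx, mul_one, Real.norm_eq_abs]
    linarith
  have h3 : ‖z‖⁻¹ • z - x = ‖z‖⁻¹ • (z - ‖z‖ • x) := by
    rw [smul_sub, inv_smul_smul₀ hz'.ne']
  rw [h3, norm_smul, norm_inv, norm_norm, inv_mul_eq_div]
  gcongr

/-- Unit vectors with an inner ellipsoid are dense in the unit sphere of a renormed Hilbert space. -/
theorem exists_admitsInnerEllipsoid_norm_sub_lt {H : Type*} [NormedAddCommGroup H]
    [InnerProductSpace ℝ H] [CompleteSpace H] (V : X ≃L[ℝ] H) {x : X} (hx : ‖x‖ = 1) {r : ℝ}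
    (hr : 0 < r) : ∃ y : X, ‖y‖ = 1 ∧ AdmitsInnerEllipsoid y ∧ ‖y - x‖ < r := by
  have : CompleteSpace X := (completeSpace_congr (e := V.toEquiv) V.isUniformEmbedding).2 ‹_›
  have hx0 : x ≠ 0 := by rintro rfl; simp at hx
  obtain ⟨φ, -, hφx⟩ := exists_dual_vector ℝ x (norm_ne_zero_iff.2 hx0)
  replace hφx : φ x = 1 := by simpa [hx] using hφx
  set C := ‖(V.symm : H →L[ℝ] X)‖ + 1 with hC
  have hC0 : 0 < C := by positivity
  have hCle (h : H) : ‖V.symm h‖ ≤ C * ‖h‖ :=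
    ((V.symm : H →L[ℝ] X).le_opNorm h).trans (by gcongr; simp [hC])
  -- The elongation factor: on the unit sphere of the new norm, `y` is within `r / 8` of `φ y • x`.
  set t := 8 * C / r with ht
  have ht0 : 0 < t := by positivity
  let R : X →L[ℝ] H := t • (V : X →L[ℝ] H).comp (.id ℝ X - φ.smulRight x)
  have hR (y : X) : R y = t • V (y - φ y • x) := by simp [R]
  have hRle (y : X) : ‖y - φ y • x‖ ≤ r / 8 * ‖R y‖ := by
    have h1 := hCle (V (y - φ y • x))
    rw [V.symm_apply_apply] at h1
    rw [hR, norm_smul, Real.norm_of_nonneg ht0.le]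
    refine h1.trans_eq ?_
    rw [ht]; field_simp
  let B : X →L[ℝ] X →L[ℝ] ℝ := φ.smulRight φ + (innerForm H).bilinearComp R R
  have hB (y w : X) : B y w = φ y * φ w + ⟪R y, R w⟫_ℝ := by simp [B, innerForm_apply]
  have hBB (y : X) : B y y = φ y ^ 2 + ‖R y‖ ^ 2 := by
    rw [hB, real_inner_self_eq_norm_sq, sq (φ y)]
  have hcoer (y : X) : 1 / (2 + 2 * (r / 8) ^ 2) * ‖y‖ ^ 2 ≤ B y y := by
    have h1 : ‖y‖ ≤ |φ y| + r / 8 * ‖R y‖ := by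
      have h2 : ‖y‖ ≤ ‖φ y • x‖ + ‖y - φ y • x‖ := by
        simpa using norm_add_le (φ y • x) (y - φ y • x)
      rw [norm_smul, hx, mul_one, Real.norm_eq_abs] at h2
      linarith [hRle y]
    have h2 := pow_le_pow_left₀ (norm_nonneg y) h1 2
    rw [one_div, inv_mul_le_iff₀ (by positivity), hBB]
    refine h2.trans ((add_sq_le).trans ?_)
    rw [sq_abs, mul_pow]
    nlinarith [mul_nonneg (sq_nonneg (r / 8)) (sq_nonneg (φ y)), sq_nonneg ‖R y‖]
  obtain ⟨K, _, _, _, U, hU⟩ := exists_innerProductSpace_of_coercive B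
    (fun y w => by rw [hB, hB, real_inner_comm, mul_comm]) (by positivity) hcoer
  have : Nontrivial X := ⟨x, 0, hx0⟩
  have : Nontrivial K := U.toEquiv.nontrivial
  obtain ⟨k, hk, hin, hmax⟩ :=
    exists_admitsInnerEllipsoid_of_continuousLinearEquiv U (δ := 3 / 4) (by norm_num)
  -- `x` itself has norm one in `K`, so the near maximizer `U k` has norm at least `1 / 2`.
  have hkx : ‖U.symm x‖ = 1 := by
    rw [← pow_eq_one_iff_of_nonneg (norm_nonneg _) two_ne_zero, hU, U.apply_symm_apply, hBB, hR]
    simp [hφx]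
  have hz : 1 / 2 ≤ ‖U k‖ := by
    have := hmax _ hkx
    rw [U.apply_symm_apply, hx] at this
    exact abs_le_of_sq_le_sq' (by linarith) (norm_nonneg _) |>.2
  set z := U k with hzdef
  have hz0 : z ≠ 0 := by rintro h; rw [h, norm_zero] at hz; norm_num at hz
  have hRz : ‖R z‖ ≤ 1 := by
    have h1 := hU k
    rw [hk, hBB] at h1
    rw [← sq_le_one_iff₀ (norm_nonneg _)]
    nlinarith [sq_nonneg (φ z)]
  have hzle : ‖z - φ z • x‖ ≤ r / 8 := (hRle z).trans (mul_le_of_le_one_right (by positivity) hRz)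
  have hlt : 2 * (r / 8) / ‖z‖ < r := by
    rw [div_lt_iff₀ (norm_pos_iff.2 hz0)]
    nlinarith
  -- `z` is close to a multiple of `x`; if that multiple is negative, `-z` is used instead.
  rcases le_total 0 (φ z) with hs | hs
  · exact ⟨‖z‖⁻¹ • z, norm_smul_inv_norm hz0, hin,
      (norm_inv_smul_sub_le hx hz0 hs hzle).trans_lt hlt⟩
  · refine ⟨‖-z‖⁻¹ • (-z), norm_smul_inv_norm (neg_ne_zero.2 hz0), ?_,
      (norm_inv_smul_sub_le hx (neg_ne_zero.2 hz0) (neg_nonneg.2 hs)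
        (τ := r / 8) ?_).trans_lt ?_⟩
    · rw [norm_neg, smul_neg]
      exact hin.map (T := ContinuousLinearEquiv.neg ℝ) (fun x => by simp)
    · rwa [neg_smul, ← neg_sub', norm_neg]
    · rwa [norm_neg]

/-! ### Contractive automorphisms and the characterization of semitransitivity -/

theorem norm_apply_le_of_mem_contractiveAut {T : X ≃L[ℝ] X} (hT : T ∈ contractiveAut X) (x : X) :
    ‖T x‖ ≤ ‖x‖ := by
  have h : LipschitzWith 1 T := hT
  simpa using h.norm_le_mul (map_zero T) x

/-- An outer ellipsoid at `x` and an inner ellipsoid at `y` give a contractive automorphism from `x`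
to `y`: an isometry of the Hilbert spaces behind the two ellipsoids. -/
theorem exists_contractive_apply_eq {x y : X} (hy : ‖y‖ = 1)
    (hxo : AdmitsOuterEllipsoid x) (hyi : AdmitsInnerEllipsoid y) :
    ∃ T ∈ contractiveAut X, y = T x := by
  obtain ⟨_, ⟨K, _, _, _, V, rfl⟩, hx, hBV⟩ := hxo
  obtain ⟨_, ⟨L, _, _, _, U, rfl⟩, ⟨u, hu, rfl⟩, hUB⟩ := hyi
  rw [V.frontier_image_closedBall] at hx
  obtain ⟨v, hv, rfl⟩ := hx
  rw [mem_sphere_zero_iff_norm] at hv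
  rw [mem_closedBall_zero_iff] at hu
  have hU (l : L) : ‖U l‖ ≤ ‖l‖ := by
    rcases eq_or_ne l 0 with rfl | hl
    · simp
    have h : U (‖l‖⁻¹ • l) ∈ closedBall (0 : X) 1 :=
      hUB ⟨_, by simp [norm_smul, hl], rfl⟩
    rw [mem_closedBall_zero_iff, map_smul, norm_smul, norm_inv, norm_norm,
      inv_mul_le_one₀ (norm_pos_iff.2 hl)] at h
    exact h
  have hV (x : X) : ‖V.symm x‖ ≤ ‖x‖ := by
    rcases eq_or_ne x 0 with rfl | hx
    · simp
    obtain ⟨k, hk, hkx⟩ := hBV (show ‖x‖⁻¹ • x ∈ closedBall (0 : X) 1 by simp [norm_smul, hx])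
    rw [mem_closedBall_zero_iff, ← V.symm_apply_apply k, hkx, map_smul, norm_smul, norm_inv,
      norm_norm, inv_mul_le_one₀ (norm_pos_iff.2 hx)] at hk
    exact hk
  have hu' : ‖u‖ = 1 := hu.antisymm (hy ▸ hU u)
  obtain ⟨W⟩ := (V.trans U.symm).nonempty_linearIsometryEquiv
  have hWv : ‖W v‖ = ‖u‖ := by rw [W.norm_map, hv, hu']
  -- The reflection swapping `W v` and `u`, which have the same norm.
  let R := Submodule.reflection (ℝ ∙ (W v - u))ᗮ
  refine ⟨V.symm.trans ((W.trans R).toContinuousLinearEquiv.trans U), ?_, ?_⟩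
  · refine LipschitzWith.of_dist_le_mul fun a b => ?_
    rw [dist_eq_norm, dist_eq_norm, ← map_sub, NNReal.coe_one, one_mul]
    refine (hU _).trans ?_
    change ‖(W.trans R) (V.symm (a - b))‖ ≤ ‖a - b‖
    rw [LinearIsometryEquiv.norm_map]
    exact hV (a - b)
  · simp [R, Submodule.reflection_sub hWv]

end Renorming

theorem mainTheorem8 {H X : Type*}
    [NormedAddCommGroup H] [InnerProductSpace ℝ H] [CompleteSpace H]
    [NormedAddCommGroup X] [NormedSpace ℝ X] (hX : Nonempty (H ≃L[ℝ] X)) :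
    (IsSemitransitive X ↔
      ∀ x ∈ Metric.sphere (0 : X) 1, AdmitsInnerEllipsoid x ∧ AdmitsOuterEllipsoid x) ∧
    Dense {x : Metric.sphere (0 : X) 1 | AdmitsInnerEllipsoid (x : X)} ∧
    (Nontrivial X → ∃ x ∈ Metric.sphere (0 : X) 1, AdmitsOuterEllipsoid x) := by
  obtain ⟨V⟩ := hX
  have hinner {x : X} (hx : ‖x‖ = 1) {r : ℝ} (hr : 0 < r) :=
    exists_admitsInnerEllipsoid_norm_sub_lt V.symm hx hr
  have houter (_ : Nontrivial X) : ∃ x : X, ‖x‖ = 1 ∧ AdmitsOuterEllipsoid x :=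
    have : Nontrivial H := V.toEquiv.nontrivial
    exists_admitsOuterEllipsoid_of_continuousLinearEquiv V
  simp only [mem_sphere_zero_iff_norm]
  refine ⟨⟨fun hsemi x hx => ?_, fun h x hx y hy => ?_⟩, ?_, houter⟩
  · have hx' : x ∈ sphere (0 : X) 1 := mem_sphere_zero_iff_norm.2 hx
    obtain ⟨y, hy, hyi, -⟩ := hinner hx one_pos
    obtain ⟨z, hz, hzo⟩ := houter ⟨x, 0, by rintro rfl; simp at hx⟩
    obtain ⟨T, hT, rfl⟩ := hsemi y (mem_sphere_zero_iff_norm.2 hy) x hx'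
    obtain ⟨S, hS, rfl⟩ := hsemi _ hx' z (mem_sphere_zero_iff_norm.2 hz)
    exact ⟨hyi.map (norm_apply_le_of_mem_contractiveAut hT),
      hzo.of_map (norm_apply_le_of_mem_contractiveAut hS)⟩
  · rw [mem_sphere_zero_iff_norm] at hx hy
    exact exists_contractive_apply_eq hy (h x hx).2 (h y hy).1
  · refine Metric.dense_iff.2 fun x r hr => ?_
    obtain ⟨y, hy, hyi, hyx⟩ := hinner (mem_sphere_zero_iff_norm.1 x.2) hr
    exact ⟨⟨y, mem_sphere_zero_iff_norm.2 hy⟩, by simpa [Subtype.dist_eq, dist_eq_norm] using hyx,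
      hyi⟩
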